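/- **Theorem (asymptotic kinematic isotropy).** Let $\tilde M$ be a smooth four-dimensional manifold with a metric $\tilde g$ that is Lorentzian (signature $(-,+,+,+)$, in particular non-degenerate), of class at least $C^2$ and time-oriented on an open neighbourhood $U$ of $\{T=0\}$, where $T:\tilde M\to\mathbb R$ is a smooth cosmic time function, i.e. on $U$ the function $T$ increases along every future-directed causal curve and its gradient is timelike and nowhere zero. Let $\Omega$ be a real function of one variable and let $g=\Omega^2(T)\,\tilde g$ be the physical metric on the open submanifold $M$, where $M=\{T<0\}$ in cases (i), (ii) below (limits $T\to0^-$) and $M=\{T>0\}$ in cases (iii), (iv) (limits $T\to0^+$). Suppose that one of the following holds for some $c>0$: 1. (i) $\Omega(t)\to+\infty$ as $t\to0^-$, and $\Omega$ is positive, $C^2$ and strictly increasing on $[-c,0)$; 2. (ii) $\Omega(0)=0$, and $\Omega$ is positive, $C^2$ and strictly decreasing on $[-c,0)$, and continuous on $[-c,0]$; 3. (iii) $\Omega(t)\to+\infty$ as $t\to0^+$, and $\Omega$ is positive, $C^2$ and strictly decreasing on $(0,c]$; 4. (iv) $\Omega(0)=0$, and $\Omega$ is positive, $C^2$ and strictly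 increasing on $(0,c]$, and continuous on $[0,c]$; and that $\lambda=\lim_{T\to0^\pm}L$, $L=\frac{\Omega''}{\Omega}\left(\frac{\Omega}{\Omega'}\right)^2$, exists in $[-\infty,+\infty]$ with $\lambda\neq1$. Let $u$ be a unit timelike congruence in $(M,g)$, so $u^au_a=-1$, which is regular at and orthogonal to the slice $T=0$: there is a $\tilde g$-unit timelike vector field $\tilde u$ of class at least $C^2$ on an open neighbourhood of $\{T=0\}$ with $\tilde u=\Omega u$ in $M$, and $\tilde u$ is $\tilde g$-orthogonal to the slice $T=0$. Let $\theta=u^a{}_{;a}$ be the expansion, $\dot u^a=u^a{}_{;b}u^b$ the acceleration, $h_{ab}=g_{ab}+u_au_b$, $\sigma_{ab}=u_{(a;b)}+\dot u_{(a}u_{b)}-\frac13\theta h_{ab}$ the shear, $\omega_{ab}=u_{[a;b]}+\dot u_{[a}u_{b]}$ the vorticity, $\sigma^2=\frac12\sigma_{ab}\sigma^{ab}$ and $\omega^2=\frac12\omega_{ab}\omega^{ab}$, all formed with $g$ and its Levi-Civita connection. Then, as $T\to0^\pm$, i.e. as $p\to p_0$ within $M$ for every point $p_0$ of the slice $T=0$,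 the expansion $\theta$ is eventually non-zero and $$\frac{\sigma^2}{\theta^2}\to0,\qquad \frac{\omega^2}{\theta^2}\to0,\qquad \frac{\dot u^a\dot u_a}{\theta^2}\to0 .$$ -/

import Mathlib

open Set Filter Topology
open scoped Manifold ContDiff

noncomputable section

namespace ConformalCosmology

/-! ### Kinematic quantities of a congruence in local coordinates

Signature `(-,+,+,+)`, dimension four.  `G x a b` are the covariant components of a metric and
`u x a` the contravariant components of a vector field at the coordinate point `x`. -/

/-- The coordinate space. -/
abbrev Coord := EuclideanSpace ℝ (Fin 4)

/-- The partial derivative `∂_i f` at `x`. -/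
def pderiv (i : Fin 4) (f : Coord → ℝ) (x : Coord) : ℝ :=
  fderiv ℝ f x (EuclideanSpace.single i 1)

/-- The Christoffel symbol `Γ^a_{bc}` of the Levi-Civita connection of `G`. -/
def christoffel (G : Coord → Matrix (Fin 4) (Fin 4) ℝ) (x : Coord) (a b c : Fin 4) : ℝ :=
  (1 / 2) * ∑ d, (G x)⁻¹ a d *
    (pderiv b (fun y => G y d c) x + pderiv c (fun y => G y d b) x - pderiv d (fun y => G y b c) x)

/-- The covariant derivative `u^a_{;b} = ∂_b u^a + Γ^a_{bc} u^c`. -/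
def covDeriv (G : Coord → Matrix (Fin 4) (Fin 4) ℝ) (u : Coord → Fin 4 → ℝ) (x : Coord)
    (a b : Fin 4) : ℝ :=
  pderiv b (fun y => u y a) x + ∑ c, christoffel G x a b c * u x c

/-- Lowering an index: `v_a = g_{ab} v^b`. -/
def lower (g : Matrix (Fin 4) (Fin 4) ℝ) (v : Fin 4 → ℝ) (a : Fin 4) : ℝ :=
  ∑ b, g a b * v b

/-- The covariant components `u_{a;b} = g_{ac} u^c_{;b}`. -/
def covDerivLow (G : Coord → Matrix (Fin 4) (Fin 4) ℝ) (u : Coord → Fin 4 → ℝ) (x : Coord)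
    (a b : Fin 4) : ℝ :=
  ∑ c, G x a c * covDeriv G u x c b

/-- The expansion scalar `θ = u^a_{;a}`. -/
def coordExpansion (G : Coord → Matrix (Fin 4) (Fin 4) ℝ) (u : Coord → Fin 4 → ℝ)
    (x : Coord) : ℝ :=
  ∑ a, covDeriv G u x a a

/-- The acceleration vector `u̇^a = u^a_{;b} u^b`. -/
def coordAccel (G : Coord → Matrix (Fin 4) (Fin 4) ℝ) (u : Coord → Fin 4 → ℝ) (x : Coord)
    (a : Fin 4) : ℝ :=
  ∑ b, covDeriv G u x a b * u x b

/-- The acceleration scalar `u̇^a u̇_a`. -/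
def coordAccelSq (G : Coord → Matrix (Fin 4) (Fin 4) ℝ) (u : Coord → Fin 4 → ℝ)
    (x : Coord) : ℝ :=
  ∑ a, coordAccel G u x a * lower (G x) (coordAccel G u x) a

/-- The projection tensor `h_{ab} = g_{ab} + u_a u_b` onto the rest space of `u`. -/
def projTensor (G : Coord → Matrix (Fin 4) (Fin 4) ℝ) (u : Coord → Fin 4 → ℝ) (x : Coord)
    (a b : Fin 4) : ℝ :=
  G x a b + lower (G x) (u x) a * lower (G x) (u x) b

/-- The shear tensor `σ_{ab} = u_{(a;b)} + u̇_{(a} u_{b)} - (θ / 3) h_{ab}`. -/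
def shearTensor (G : Coord → Matrix (Fin 4) (Fin 4) ℝ) (u : Coord → Fin 4 → ℝ) (x : Coord)
    (a b : Fin 4) : ℝ :=
  (covDerivLow G u x a b + covDerivLow G u x b a) / 2
    + (lower (G x) (coordAccel G u x) a * lower (G x) (u x) b
        + lower (G x) (coordAccel G u x) b * lower (G x) (u x) a) / 2
    - coordExpansion G u x / 3 * projTensor G u x a b

/-- The vorticity tensor `ω_{ab} = u_{[a;b]} + u̇_{[a} u_{b]}`. -/
def vorticityTensor (G : Coord → Matrix (Fin 4) (Fin 4) ℝ) (u : Coord → Fin 4 → ℝ) (x : Coord)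
    (a b : Fin 4) : ℝ :=
  (covDerivLow G u x a b - covDerivLow G u x b a) / 2
    + (lower (G x) (coordAccel G u x) a * lower (G x) (u x) b
        - lower (G x) (coordAccel G u x) b * lower (G x) (u x) a) / 2

/-- `S_{ab} S^{ab} = g^{ac} g^{bd} S_{ab} S_{cd}`. -/
def contractSq (g : Matrix (Fin 4) (Fin 4) ℝ) (S : Fin 4 → Fin 4 → ℝ) : ℝ :=
  ∑ a, ∑ b, ∑ c, ∑ d, g⁻¹ a c * g⁻¹ b d * S a b * S c d

/-- The shear scalar `σ² = σ_{ab} σ^{ab} / 2`. -/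
def coordShearSq (G : Coord → Matrix (Fin 4) (Fin 4) ℝ) (u : Coord → Fin 4 → ℝ)
    (x : Coord) : ℝ :=
  (1 / 2) * contractSq (G x) (shearTensor G u x)

/-- The vorticity scalar `ω² = ω_{ab} ω^{ab} / 2`. -/
def coordVorticitySq (G : Coord → Matrix (Fin 4) (Fin 4) ℝ) (u : Coord → Fin 4 → ℝ)
    (x : Coord) : ℝ :=
  (1 / 2) * contractSq (G x) (vorticityTensor G u x)

/-! ### Tensor fields on a four-manifold and their components -/

section Manifold

variable {M : Type*} [TopologicalSpace M] [ChartedSpace Coord M] [IsManifold (𝓡 4) ∞ M]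

/-- A vector field on `M`. -/
abbrev VField (M : Type*) [TopologicalSpace M] [ChartedSpace Coord M] :=
  ∀ p : M, TangentSpace (𝓡 4) p

/-- A covariant tensor field of rank two on `M`. -/
abbrev BilinField (M : Type*) [TopologicalSpace M] [ChartedSpace Coord M] :=
  ∀ p : M, TangentSpace (𝓡 4) p →L[ℝ] TangentSpace (𝓡 4) p →L[ℝ] ℝ

/-- The coordinate vector field `∂/∂x^i` of the chart `e` at the point with coordinates `x`. -/
def coordVector (e : OpenPartialHomeomorph M Coord) (x : Coord) (i : Fin 4) :
    TangentSpace (𝓡 4) (e.symm x) :=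
  mfderiv (𝓡 4) (𝓡 4) e.symm x (EuclideanSpace.single i (1 : ℝ) : Coord)

/-- The components `g_{ij} = g(∂/∂x^i, ∂/∂x^j)` in the chart `e`. -/
def metricComp (e : OpenPartialHomeomorph M Coord) (g : BilinField M) (x : Coord) :
    Matrix (Fin 4) (Fin 4) ℝ :=
  Matrix.of fun i j => g (e.symm x) (coordVector e x i) (coordVector e x j)

/-- The components `u^i = dx^i(u)` in the chart `e`. -/
def vectorComp (e : OpenPartialHomeomorph M Coord) (u : VField M) (x : Coord) : Fin 4 → ℝ :=
  fun i => (show Coord from mfderiv (𝓡 4) (𝓡 4) e (e.symm x) (u (e.symm x))) i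

/-- `θ` at `p`, computed in the chart `e` around `p`.  Like the next three quantities it is a
scalar: the value is the same for every chart of the smooth atlas around `p`. -/
def expansion (e : OpenPartialHomeomorph M Coord) (g : BilinField M) (u : VField M) (p : M) : ℝ :=
  coordExpansion (metricComp e g) (vectorComp e u) (e p)

/-- `σ²` at `p`, computed in the chart `e` around `p`. -/
def shearSq (e : OpenPartialHomeomorph M Coord) (g : BilinField M) (u : VField M) (p : M) : ℝ :=
  coordShearSq (metricComp e g) (vectorComp e u) (e p)

/-- `ω²` at `p`, computed in the chart `e` around `p`. -/
def vorticitySq (e : OpenPartialHomeomorph M Coord) (g : BilinField M) (u : VField M)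
    (p : M) : ℝ :=
  coordVorticitySq (metricComp e g) (vectorComp e u) (e p)

/-- `u̇^a u̇_a` at `p`, computed in the chart `e` around `p`. -/
def accelSq (e : OpenPartialHomeomorph M Coord) (g : BilinField M) (u : VField M) (p : M) : ℝ :=
  coordAccelSq (metricComp e g) (vectorComp e u) (e p)

/-! ### Lorentzian metrics, causality and cosmic time -/

/-- `g` is a nondegenerate symmetric form of signature `(-,+,+,+)` at `p`: it has an orthonormal
basis. -/
def IsLorentzianAt (g : BilinField M) (p : M) : Prop :=
  ∃ b : Module.Basis (Fin 4) ℝ (TangentSpace (𝓡 4) p), ∀ i j,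
    g p (b i) (b j) = if i = j then (if i = 0 then -1 else 1) else 0

/-- `g` is a `C^n` Lorentzian metric on the set `U`. -/
structure IsLorentzMetricOn (n : ℕ∞) (g : BilinField M) (U : Set M) : Prop where
  lorentzian : ∀ p ∈ U, IsLorentzianAt g p
  contMDiffOn : ContMDiffOn (𝓡 4) ((𝓡 4).prod 𝓘(ℝ, Coord →L[ℝ] Coord →L[ℝ] ℝ)) n
    (fun p => Bundle.TotalSpace.mk' (Coord →L[ℝ] Coord →L[ℝ] ℝ)
      (E := fun p : M => TangentSpace (𝓡 4) p →L[ℝ] TangentSpace (𝓡 4) p →L[ℝ] ℝ) p (g p)) U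

/-- The vector field `u` is of class `C^n` on `U`. -/
def IsVFieldOfClassOn (n : ℕ∞) (u : VField M) (U : Set M) : Prop :=
  ContMDiffOn (𝓡 4) (𝓡 4).tangent n (fun p => (⟨p, u p⟩ : TangentBundle (𝓡 4) M)) U

/-- `u` is a field of unit timelike vectors on `U`. -/
def IsUnitTimelikeOn (g : BilinField M) (u : VField M) (U : Set M) : Prop :=
  ∀ p ∈ U, g p (u p) (u p) = -1

/-- The continuous timelike vector field `τ` is a time orientation of `(U, g)`. -/
structure IsTimeOrientationOn (g : BilinField M) (τ : VField M) (U : Set M) : Prop where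
  timelike : ∀ p ∈ U, g p (τ p) (τ p) < 0
  continuousOn : IsVFieldOfClassOn 0 τ U

/-- `v` is a future-directed causal (timelike or null, nonzero) vector at `p`. -/
def IsFutureCausal (g : BilinField M) (τ : VField M) (p : M) (v : TangentSpace (𝓡 4) p) : Prop :=
  v ≠ 0 ∧ g p v v ≤ 0 ∧ g p v (τ p) < 0

/-- `γ : [a, b] → U` is a future-directed causal `C^1` curve. -/
structure IsFutureCausalCurve (g : BilinField M) (τ : VField M) (U : Set M)
    (γ : ℝ → M) (a b : ℝ) : Prop where
  lt : a < b
  mapsTo : MapsTo γ (Icc a b) U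
  contMDiffOn : ContMDiffOn 𝓘(ℝ, ℝ) (𝓡 4) 1 γ (Icc a b)
  futureCausal : ∀ t ∈ Icc a b,
    IsFutureCausal g τ (γ t) (mfderivWithin 𝓘(ℝ, ℝ) (𝓡 4) γ (Icc a b) t (1 : ℝ))

/-- The differential `dT(v)` of a scalar function. -/
def dirDeriv (T : M → ℝ) (p : M) (v : TangentSpace (𝓡 4) p) : ℝ :=
  show ℝ from mfderiv (𝓡 4) 𝓘(ℝ, ℝ) T p v

/-- `T` is a smooth cosmic time function for `g` on `U`: it increases along every future-directed
causal curve, and its gradient is (nowhere zero and) timelike. -/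
structure IsSmoothCosmicTimeOn (g : BilinField M) (τ : VField M) (T : M → ℝ) (U : Set M) :
    Prop where
  smooth : ContMDiff (𝓡 4) 𝓘(ℝ, ℝ) ∞ T
  increasing : ∀ (γ : ℝ → M) (a b : ℝ), IsFutureCausalCurve g τ U γ a b → T (γ a) < T (γ b)
  gradient_timelike : ∀ p ∈ U, ∃ n : TangentSpace (𝓡 4) p,
    g p n n < 0 ∧ ∀ v, dirDeriv T p v = g p n v

/-! ### Conformal rescaling -/

/-- The physical metric `g = Ω(T)² g̃`. -/
def physicalMetric (g : BilinField M) (T : M → ℝ) (Ω : ℝ → ℝ) : BilinField M :=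
  fun p => (Ω (T p)) ^ 2 • g p

/-- The congruence `u` of the physical space-time `{T ∈ s}` is regular at, and orthogonal to, the
slice `T = 0`: there is a unit timelike congruence `ũ` of class `C^2` on an open neighbourhood of
the slice with `ũ = Ω u` in the physical space-time, and `ũ` is orthogonal to the slice, whose
tangent vectors are the `v` with `dT(v) = 0`. -/
def IsRegularOrthogonalAtSlice (g : BilinField M) (T : M → ℝ) (Ω : ℝ → ℝ) (s : Set ℝ)
    (u : VField M) : Prop :=
  ∃ (V : Set M) (w : VField M), IsOpen V ∧ {p | T p = 0} ⊆ V ∧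
    IsVFieldOfClassOn 2 w V ∧ IsUnitTimelikeOn g w V ∧
    (∀ p ∈ V, T p ∈ s → w p = Ω (T p) • u p) ∧
    (∀ p, T p = 0 → ∀ v : TangentSpace (𝓡 4) p, dirDeriv T p v = 0 → g p (w p) v = 0)

end Manifold

/-- The four admissible behaviours of the conformal factor at `0`.  The set `s` is the side from
which `0` is approached: `Iio 0` for `T → 0⁻` and `Ioi 0` for `T → 0⁺`. -/
inductive ConformalFactorCondition (Ω : ℝ → ℝ) : Set ℝ → Prop
  | diverging_below (c : ℝ) (hc : 0 < c) (lim : Tendsto Ω (𝓝[<] 0) atTop)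
      (pos : ∀ t ∈ Ico (-c) 0, 0 < Ω t) (smooth : ContDiffOn ℝ 2 Ω (Ico (-c) 0))
      (mono : StrictMonoOn Ω (Ico (-c) 0)) : ConformalFactorCondition Ω (Iio 0)
  | vanishing_below (c : ℝ) (hc : 0 < c) (zero : Ω 0 = 0)
      (pos : ∀ t ∈ Ico (-c) 0, 0 < Ω t) (smooth : ContDiffOn ℝ 2 Ω (Ico (-c) 0))
      (anti : StrictAntiOn Ω (Ico (-c) 0)) (cont : ContinuousOn Ω (Icc (-c) 0)) :
      ConformalFactorCondition Ω (Iio 0)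
  | diverging_above (c : ℝ) (hc : 0 < c) (lim : Tendsto Ω (𝓝[>] 0) atTop)
      (pos : ∀ t ∈ Ioc 0 c, 0 < Ω t) (smooth : ContDiffOn ℝ 2 Ω (Ioc 0 c))
      (anti : StrictAntiOn Ω (Ioc 0 c)) : ConformalFactorCondition Ω (Ioi 0)
  | vanishing_above (c : ℝ) (hc : 0 < c) (zero : Ω 0 = 0)
      (pos : ∀ t ∈ Ioc 0 c, 0 < Ω t) (smooth : ContDiffOn ℝ 2 Ω (Ioc 0 c))
      (mono : StrictMonoOn Ω (Ioc 0 c)) (cont : ContinuousOn Ω (Icc 0 c)) :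
      ConformalFactorCondition Ω (Ioi 0)

/-- `L = (Ω'' / Ω) (Ω / Ω')²`. -/
def ratioL (Ω : ℝ → ℝ) (t : ℝ) : ℝ :=
  deriv (deriv Ω) t / Ω t * (Ω t / deriv Ω t) ^ 2

/-- `λ = lim L`, as `t → 0` within `s`, exists as a finite or infinite limit, and `λ ≠ 1`. -/
def LimitLExistsNeOne (Ω : ℝ → ℝ) (s : Set ℝ) : Prop :=
  ∃ l : EReal, l ≠ 1 ∧ Tendsto (fun t => (ratioL Ω t : EReal)) (𝓝[s] 0) (𝓝 l)

end ConformalCosmology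

end

/-!
Write `g̃` for the regular metric (called `g` in the theorem), `ũ = Ω u` for the regular
congruence, and `y = Ω' / Ω`.  Under `g = Ω² g̃` the kinematic quantities become

* `Ω θ = θ̃ + 3 y ũ(T)`,
* `Ω² σ² = σ̃²` and `Ω² ω² = ω̃²`,
* `Ω² u̇^a u̇_a = |a + y P|²`, where `a` is the acceleration of `ũ` and `P^a = ∇^a T + ũ(T) ũ^a` is
  the part of the `g̃`-gradient of `T` orthogonal to `ũ`

(lemmas of the namespace `IsConformalAt`).  All quantities formed with `g̃`, `ũ` and `T` are
continuous at the slice.  On the slice `ũ(T) ≠ 0`, because a unit timelike vector that is orthogonal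
to the slice cannot be tangent to it, and `P = 0`, because the gradient of `T` is then parallel to
`ũ`.  Hence all four assertions follow by dividing by powers of `y`, once `|y| → ∞` is known.

This blow-up is where the asymptotic conditions on `Ω` and `L` enter.  The function `y`
satisfies the Riccati equation `y' = (L - 1) y²`; since `λ ≠ 1`, the factor `L - 1` is eventually of constant sign, so `y`
is eventually monotone.  If `y` were bounded, `log Ω` would be Lipschitz and so bounded near `0`,
whereas `Ω → ∞` or `Ω → 0`.  A monotone unbounded `y` tends to `±∞`
(`ConformalFactorCondition.tendsto_abs_deriv_div_self`).  Zeros of `Ω'` need no separate treatment: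
the sign of `Ω'` being constant, `Ω''` vanishes there as well, so that the Riccati equation persists.
-/

noncomputable section

namespace ConformalCosmology

/-! ### The logarithmic derivative of the conformal factor -/

/-- A monotone derivative of a function that is unbounded at `0⁺` tends to `-∞`: if it were bounded,
the function would be Lipschitz. -/
lemma tendsto_atBot_of_monotoneOn_deriv {ψ y : ℝ → ℝ} {δ : ℝ} (hδ : 0 < δ)
    (hψ : ∀ t ∈ Ioo 0 δ, HasDerivAt ψ (y t) t) (hy : MonotoneOn y (Ioo 0 δ))
    (hlim : Tendsto (fun t => |ψ t|) (𝓝[>] 0) atTop) : Tendsto y (𝓝[>] 0) atBot := by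
  rw [tendsto_atBot]
  intro b
  by_cases h : ∃ t ∈ Ioo 0 δ, y t ≤ b
  · obtain ⟨t, ht, hb⟩ := h
    filter_upwards [Ioo_mem_nhdsGT ht.1] with r hr
    exact (hy ⟨hr.1, hr.2.trans ht.2⟩ ht hr.2.le).trans hb
  · push Not at h
    exfalso
    have hm : δ / 2 ∈ Ioo 0 δ := ⟨by linarith, by linarith⟩
    set K := |b| + |y (δ / 2)|
    have hK : ∀ t ∈ Ioc 0 (δ / 2), ‖y t‖ ≤ K := by
      intro t ht
      have h1 := (h t ⟨ht.1, ht.2.trans_lt hm.2⟩).le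
      have h2 := hy ⟨ht.1, ht.2.trans_lt hm.2⟩ hm ht.2
      rw [Real.norm_eq_abs, abs_le]
      constructor <;>
      linarith [neg_abs_le b, le_abs_self (y (δ / 2)), abs_nonneg b, abs_nonneg (y (δ / 2))]
    have hlip : ∀ t ∈ Ioc 0 (δ / 2), |ψ t| ≤ |ψ (δ / 2)| + K * (δ / 2) := by
      intro t ht
      have h1 := (convex_Ioc (0 : ℝ) (δ / 2)).norm_image_sub_le_of_norm_hasDerivWithin_le
        (fun r hr => (hψ r ⟨hr.1, hr.2.trans_lt hm.2⟩).hasDerivWithinAt) hK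
        (right_mem_Ioc.2 hm.1) ht
      have h2 : ‖t - δ / 2‖ ≤ δ / 2 := by
        rw [Real.norm_eq_abs, abs_le]; constructor <;> linarith [ht.1, ht.2]
      have h3 : K * ‖t - δ / 2‖ ≤ K * (δ / 2) :=
        mul_le_mul_of_nonneg_left h2 (by positivity)
      have h4 := abs_sub_abs_le_abs_sub (ψ t) (ψ (δ / 2))
      rw [Real.norm_eq_abs] at h1
      linarith
    obtain ⟨t, ht, ht'⟩ := ((hlim.eventually_gt_atTop (|ψ (δ / 2)| + K * (δ / 2))).and
      (Ioc_mem_nhdsGT hm.1)).exists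
    exact (hlip t ht').not_gt ht

/-- The Riccati equation `y' = (L - 1) y²` for `y = Ω' / Ω`.  It also holds where `Ω'` vanishes:
since `Ω'` has constant sign, it has an extremum there and `Ω''` vanishes as well. -/
lemma hasDerivAt_deriv_div_self {Ω : ℝ → ℝ} {S : Set ℝ} (hS : IsOpen S)
    (pos : ∀ t ∈ S, 0 < Ω t) (smooth : ContDiffOn ℝ 2 Ω S)
    (sgn : (∀ t ∈ S, 0 ≤ deriv Ω t) ∨ ∀ t ∈ S, deriv Ω t ≤ 0) {t : ℝ} (ht : t ∈ S) :
    HasDerivAt (fun r => deriv Ω r / Ω r) ((ratioL Ω t - 1) * (deriv Ω t / Ω t) ^ 2) t := by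
  have hd : HasDerivAt Ω (deriv Ω t) t :=
    ((smooth.differentiableOn (by norm_num)).differentiableAt (hS.mem_nhds ht)).hasDerivAt
  have hd2 : HasDerivAt (deriv Ω) (deriv (deriv Ω) t) t :=
    (((smooth.deriv_of_isOpen hS (m := 1) (by norm_num)).differentiableOn
      (by norm_num)).differentiableAt (hS.mem_nhds ht)).hasDerivAt
  have h0 : deriv Ω t = 0 → deriv (deriv Ω) t = 0 := by
    intro h
    rcases sgn with h' | h'
    · refine IsLocalMin.deriv_eq_zero ?_
      filter_upwards [hS.mem_nhds ht] with r hr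
      rw [h]; exact h' r hr
    · refine IsLocalMax.deriv_eq_zero ?_
      filter_upwards [hS.mem_nhds ht] with r hr
      rw [h]; exact h' r hr
  have hp := (pos t ht).ne'
  refine (hd2.fun_div hd hp).congr_deriv ?_
  unfold ratioL
  by_cases h : deriv Ω t = 0
  · rw [h0 h, h]; simp
  · field_simp

/-- The logarithmic derivative of the conformal factor blows up at `0⁺`.  By the Riccati equation it
is monotone as soon as `L - 1` has constant sign, and it is unbounded because `log Ω` is. -/
lemma tendsto_abs_deriv_div_self_nhdsGT {Ω : ℝ → ℝ} {c : ℝ} (hc : 0 < c)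
    (pos : ∀ t ∈ Ioo 0 c, 0 < Ω t) (smooth : ContDiffOn ℝ 2 Ω (Ioo 0 c))
    (sgn : (∀ t ∈ Ioo 0 c, 0 ≤ deriv Ω t) ∨ ∀ t ∈ Ioo 0 c, deriv Ω t ≤ 0)
    (hlog : Tendsto (fun t => |Real.log (Ω t)|) (𝓝[>] 0) atTop)
    (hL : (∀ᶠ t in 𝓝[>] 0, ratioL Ω t < 1) ∨ ∀ᶠ t in 𝓝[>] 0, 1 < ratioL Ω t) :
    Tendsto (fun t => |deriv Ω t / Ω t|) (𝓝[>] 0) atTop := by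
  have hsub : ∀ {δ : ℝ}, ∀ t ∈ Ioo 0 (min δ c), t ∈ Ioo 0 c := fun t ht =>
    ⟨ht.1, ht.2.trans_le (min_le_right _ _)⟩
  have hy := fun t (ht : t ∈ Ioo 0 c) => hasDerivAt_deriv_div_self isOpen_Ioo pos smooth sgn ht
  have hψ : ∀ t ∈ Ioo 0 c, HasDerivAt (fun r => Real.log (Ω r)) (deriv Ω t / Ω t) t :=
    fun t ht => (((smooth.differentiableOn (by norm_num)).differentiableAt
      (isOpen_Ioo.mem_nhds ht)).hasDerivAt).log (pos t ht).ne'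
  rcases hL with hL | hL
  · obtain ⟨δ, hδ, hδL⟩ := mem_nhdsGT_iff_exists_Ioo_subset.1 hL
    have hm : 0 < min δ c := lt_min hδ hc
    have hmono : MonotoneOn (fun t => -(deriv Ω t / Ω t)) (Ioo 0 (min δ c)) := by
      refine monotoneOn_of_hasDerivWithinAt_nonneg (convex_Ioo _ _)
        (fun t ht => (hy t (hsub t ht)).neg.continuousAt.continuousWithinAt)
        (fun t ht => (hy t (hsub t (interior_subset ht))).neg.hasDerivWithinAt) ?_
      intro t ht
      rw [interior_Ioo] at ht
      have h1 : ratioL Ω t < 1 := hδL ⟨ht.1, ht.2.trans_le (min_le_left _ _)⟩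
      nlinarith [sq_nonneg (deriv Ω t / Ω t)]
    have := tendsto_atBot_of_monotoneOn_deriv hm (fun t ht => (hψ t (hsub t ht)).neg) hmono
      (by simpa using hlog)
    simpa [Function.comp_def] using tendsto_abs_atBot_atTop.comp this
  · obtain ⟨δ, hδ, hδL⟩ := mem_nhdsGT_iff_exists_Ioo_subset.1 hL
    have hm : 0 < min δ c := lt_min hδ hc
    have hmono : MonotoneOn (fun t => deriv Ω t / Ω t) (Ioo 0 (min δ c)) := by
      refine monotoneOn_of_hasDerivWithinAt_nonneg (convex_Ioo _ _)
        (fun t ht => (hy t (hsub t ht)).continuousAt.continuousWithinAt)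
        (fun t ht => (hy t (hsub t (interior_subset ht))).hasDerivWithinAt) ?_
      intro t ht
      rw [interior_Ioo] at ht
      have h1 : 1 < ratioL Ω t := hδL ⟨ht.1, ht.2.trans_le (min_le_left _ _)⟩
      nlinarith [sq_nonneg (deriv Ω t / Ω t)]
    exact tendsto_abs_atBot_atTop.comp
      (tendsto_atBot_of_monotoneOn_deriv hm (fun t ht => hψ t (hsub t ht)) hmono hlog)

lemma ratioL_comp_neg (Ω : ℝ → ℝ) (t : ℝ) : ratioL (fun r => Ω (-r)) t = ratioL Ω (-t) := by
  have h1 : deriv (fun r => Ω (-r)) = fun r => -deriv Ω (-r) := funext fun r => deriv_comp_neg Ω r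
  have h2 : deriv (fun r => -deriv Ω (-r)) t = deriv (deriv Ω) (-t) := by
    rw [deriv.fun_neg, deriv_comp_neg, neg_neg]
  simp only [ratioL, h1, h2, div_neg, neg_sq]

/-- The mirror image of `tendsto_abs_deriv_div_self_nhdsGT` at `0⁻`. -/
lemma tendsto_abs_deriv_div_self_nhdsLT {Ω : ℝ → ℝ} {c : ℝ} (hc : 0 < c)
    (pos : ∀ t ∈ Ioo (-c) 0, 0 < Ω t) (smooth : ContDiffOn ℝ 2 Ω (Ioo (-c) 0))
    (sgn : (∀ t ∈ Ioo (-c) 0, 0 ≤ deriv Ω t) ∨ ∀ t ∈ Ioo (-c) 0, deriv Ω t ≤ 0)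
    (hlog : Tendsto (fun t => |Real.log (Ω t)|) (𝓝[<] 0) atTop)
    (hL : (∀ᶠ t in 𝓝[<] 0, ratioL Ω t < 1) ∨ ∀ᶠ t in 𝓝[<] 0, 1 < ratioL Ω t) :
    Tendsto (fun t => |deriv Ω t / Ω t|) (𝓝[<] 0) atTop := by
  have hneg : Tendsto (fun t : ℝ => -t) (𝓝[>] 0) (𝓝[<] 0) := by
    simpa using tendsto_neg_nhdsGT (a := (0 : ℝ))
  have hneg' : Tendsto (fun t : ℝ => -t) (𝓝[<] 0) (𝓝[>] 0) := by
    simpa using tendsto_neg_nhdsLT (a := (0 : ℝ))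
  have hmem : ∀ t ∈ Ioo 0 c, -t ∈ Ioo (-c) 0 := fun t ht =>
    ⟨by linarith [ht.2], by linarith [ht.1]⟩
  have key := tendsto_abs_deriv_div_self_nhdsGT (Ω := fun r => Ω (-r)) hc
    (fun t ht => pos _ (hmem t ht)) (smooth.comp contDiff_neg.contDiffOn hmem)
    (by
      simp only [deriv_comp_neg]
      rcases sgn with h | h
      · exact Or.inr fun t ht => neg_nonpos.2 (h _ (hmem t ht))
      · exact Or.inl fun t ht => neg_nonneg.2 (h _ (hmem t ht)))
    (hlog.comp hneg)
    (by
      simp only [ratioL_comp_neg]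
      exact hL.imp hneg.eventually hneg.eventually)
  simpa [Function.comp_def, deriv_comp_neg, neg_div] using key.comp hneg'

/-- The limit of `L` being different from `1`, the sign of `L - 1` is eventually constant. -/
lemma LimitLExistsNeOne.eventually_lt_or_gt {Ω : ℝ → ℝ} {s : Set ℝ} (h : LimitLExistsNeOne Ω s) :
    (∀ᶠ t in 𝓝[s] 0, ratioL Ω t < 1) ∨ ∀ᶠ t in 𝓝[s] 0, 1 < ratioL Ω t := by
  obtain ⟨l, hl, hlim⟩ := h
  rcases hl.lt_or_gt with h | h
  · left
    filter_upwards [hlim.eventually_lt_const h] with t ht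
    exact_mod_cast ht
  · right
    filter_upwards [hlim.eventually_const_lt h] with t ht
    exact_mod_cast ht

lemma tendsto_abs_log_of_tendsto_zero {Ω : ℝ → ℝ} {l : Filter ℝ} (h : Tendsto Ω l (𝓝 0))
    (pos : ∀ᶠ t in l, 0 < Ω t) : Tendsto (fun t => |Real.log (Ω t)|) l atTop :=
  tendsto_abs_atBot_atTop.comp (Real.tendsto_log_nhdsGT_zero.comp
    (tendsto_nhdsWithin_iff.2 ⟨h, pos⟩))

lemma ConformalFactorCondition.eventually_pos_differentiableAt {Ω : ℝ → ℝ} {s : Set ℝ}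
    (h : ConformalFactorCondition Ω s) :
    ∀ᶠ t in 𝓝[s] 0, 0 < Ω t ∧ DifferentiableAt ℝ Ω t := by
  cases h with
  | diverging_below c hc lim pos smooth mono | vanishing_below c hc zero pos smooth anti cont =>
    filter_upwards [Ioo_mem_nhdsLT (neg_lt_zero.2 hc)] with t ht
    exact ⟨pos t (Ioo_subset_Ico_self ht), (smooth.differentiableOn (by norm_num)).differentiableAt
      (Ico_mem_nhds ht.1 ht.2)⟩
  | diverging_above c hc lim pos smooth anti | vanishing_above c hc zero pos smooth mono cont =>
    filter_upwards [Ioo_mem_nhdsGT hc] with t ht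
    exact ⟨pos t (Ioo_subset_Ioc_self ht), (smooth.differentiableOn (by norm_num)).differentiableAt
      (Ioc_mem_nhds ht.1 ht.2)⟩

lemma ConformalFactorCondition.isOpen {Ω : ℝ → ℝ} {s : Set ℝ}
    (h : ConformalFactorCondition Ω s) : IsOpen s := by
  cases h
  exacts [isOpen_Iio, isOpen_Iio, isOpen_Ioi, isOpen_Ioi]

lemma deriv_nonneg_of_monotoneOn {f : ℝ → ℝ} {S : Set ℝ} (hf : MonotoneOn f S) {t : ℝ}
    (ht : S ∈ 𝓝 t) : 0 ≤ deriv f t := by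
  rw [← derivWithin_of_mem_nhds ht]
  exact hf.derivWithin_nonneg

lemma deriv_nonpos_of_antitoneOn {f : ℝ → ℝ} {S : Set ℝ} (hf : AntitoneOn f S) {t : ℝ}
    (ht : S ∈ 𝓝 t) : deriv f t ≤ 0 := by
  rw [← derivWithin_of_mem_nhds ht]
  exact hf.derivWithin_nonpos

/-- `|Ω' / Ω| → ∞` in each of the four admissible cases. -/
lemma ConformalFactorCondition.tendsto_abs_deriv_div_self {Ω : ℝ → ℝ} {s : Set ℝ}
    (h : ConformalFactorCondition Ω s) (hL : LimitLExistsNeOne Ω s) :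
    Tendsto (fun t => |deriv Ω t / Ω t|) (𝓝[s] 0) atTop := by
  have hev : ∀ᶠ t in 𝓝[s] 0, 0 < Ω t := h.eventually_pos_differentiableAt.mono fun _ ht => ht.1
  cases h with
  | diverging_below c hc lim pos smooth mono =>
    exact tendsto_abs_deriv_div_self_nhdsLT hc (fun t ht => pos t (Ioo_subset_Ico_self ht))
      (smooth.mono Ioo_subset_Ico_self)
      (Or.inl fun t ht => deriv_nonneg_of_monotoneOn mono.monotoneOn (Ico_mem_nhds ht.1 ht.2))
      (tendsto_abs_atTop_atTop.comp (Real.tendsto_log_atTop.comp lim)) hL.eventually_lt_or_gt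
  | vanishing_below c hc zero pos smooth anti cont =>
    have lim : Tendsto Ω (𝓝[<] 0) (𝓝 0) := by
      have h1 := cont 0 (right_mem_Icc.2 (neg_lt_zero.2 hc).le)
      rw [ContinuousWithinAt, zero] at h1
      exact h1.mono_left (nhdsWithin_le_of_mem (mem_of_superset
        (Ioo_mem_nhdsLT (neg_lt_zero.2 hc)) Ioo_subset_Icc_self))
    exact tendsto_abs_deriv_div_self_nhdsLT hc (fun t ht => pos t (Ioo_subset_Ico_self ht))
      (smooth.mono Ioo_subset_Ico_self)
      (Or.inr fun t ht => deriv_nonpos_of_antitoneOn anti.antitoneOn (Ico_mem_nhds ht.1 ht.2))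
      (tendsto_abs_log_of_tendsto_zero lim hev) hL.eventually_lt_or_gt
  | diverging_above c hc lim pos smooth anti =>
    exact tendsto_abs_deriv_div_self_nhdsGT hc (fun t ht => pos t (Ioo_subset_Ioc_self ht))
      (smooth.mono Ioo_subset_Ioc_self)
      (Or.inr fun t ht => deriv_nonpos_of_antitoneOn anti.antitoneOn (Ioc_mem_nhds ht.1 ht.2))
      (tendsto_abs_atTop_atTop.comp (Real.tendsto_log_atTop.comp lim)) hL.eventually_lt_or_gt
  | vanishing_above c hc zero pos smooth mono cont =>
    have lim : Tendsto Ω (𝓝[>] 0) (𝓝 0) := by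
      have h1 := cont 0 (left_mem_Icc.2 hc.le)
      rw [ContinuousWithinAt, zero] at h1
      exact h1.mono_left (nhdsWithin_le_of_mem (mem_of_superset
        (Ioo_mem_nhdsGT hc) Ioo_subset_Icc_self))
    exact tendsto_abs_deriv_div_self_nhdsGT hc (fun t ht => pos t (Ioo_subset_Ioc_self ht))
      (smooth.mono Ioo_subset_Ioc_self)
      (Or.inl fun t ht => deriv_nonneg_of_monotoneOn mono.monotoneOn (Ioc_mem_nhds ht.1 ht.2))
      (tendsto_abs_log_of_tendsto_zero lim hev) hL.eventually_lt_or_gt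

/-! ### Conformal transformation of the kinematic quantities in coordinates -/

/-- Near the coordinate point `x` the metric is `G = ρ² g` and the congruence is `u = W / ρ`, where
`W` is `g`-unit timelike at `x` and `dρ = ρ y F` at `x`. -/
structure IsConformalAt (G : Coord → Matrix (Fin 4) (Fin 4) ℝ) (u : Coord → Fin 4 → ℝ)
    (g : Coord → Matrix (Fin 4) (Fin 4) ℝ) (W : Coord → Fin 4 → ℝ) (ρ : Coord → ℝ)
    (y : ℝ) (F : Fin 4 → ℝ) (x : Coord) : Prop where
  metric_eq : ∀ᶠ z in 𝓝 x, G z = ρ z ^ 2 • g z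
  field_eq : ∀ᶠ z in 𝓝 x, u z = (ρ z)⁻¹ • W z
  factor_ne : ρ x ≠ 0
  factor_diff : DifferentiableAt ℝ ρ x
  factor_pderiv : ∀ i, pderiv i ρ x = ρ x * (y * F i)
  metric_diff : ∀ a b, DifferentiableAt ℝ (fun z => g z a b) x
  field_diff : ∀ a, DifferentiableAt ℝ (fun z => W z a) x
  metric_symm : (g x).IsSymm
  metric_det : IsUnit (g x).det
  field_unit : ∑ a, W x a * lower (g x) (W x) a = -1

/-- Raising an index: `F^a = g^{ab} F_b`. -/
def raise (g : Matrix (Fin 4) (Fin 4) ℝ) (F : Fin 4 → ℝ) (a : Fin 4) : ℝ :=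
  ∑ b, g⁻¹ a b * F b

/-- The pairing `F(w) = F_a w^a`. -/
def pairing (F w : Fin 4 → ℝ) : ℝ := ∑ a, F a * w a

/-- The vector `F^a + F(w) w^a`, which for a unit timelike `w` is the part of the gradient
orthogonal to `w`. -/
def spatialGrad (g : Matrix (Fin 4) (Fin 4) ℝ) (F w : Fin 4 → ℝ) (a : Fin 4) : ℝ :=
  raise g F a + pairing F w * w a

lemma lower_raise {g : Matrix (Fin 4) (Fin 4) ℝ} (hg : IsUnit g.det) (F : Fin 4 → ℝ) :
    lower g (raise g F) = F := by
  change g.mulVec (g⁻¹.mulVec F) = F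
  rw [Matrix.mulVec_mulVec, Matrix.mul_nonsing_inv _ hg, Matrix.one_mulVec]

lemma raise_lower {g : Matrix (Fin 4) (Fin 4) ℝ} (hg : IsUnit g.det) (v : Fin 4 → ℝ) :
    raise g (lower g v) = v := by
  change g⁻¹.mulVec (g.mulVec v) = v
  rw [Matrix.mulVec_mulVec, Matrix.nonsing_inv_mul _ hg, Matrix.one_mulVec]

lemma sum_inv_mul_eq_ite {g : Matrix (Fin 4) (Fin 4) ℝ} (hg : IsUnit g.det) (a c : Fin 4) :
    ∑ d, g⁻¹ a d * g d c = if a = c then 1 else 0 := by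
  rw [← Matrix.mul_apply, Matrix.nonsing_inv_mul _ hg, Matrix.one_apply]

lemma lower_add (g : Matrix (Fin 4) (Fin 4) ℝ) (v w : Fin 4 → ℝ) (a : Fin 4) :
    lower g (fun i => v i + w i) a = lower g v a + lower g w a := by
  simp only [lower, mul_add, Finset.sum_add_distrib]

lemma lower_mul (g : Matrix (Fin 4) (Fin 4) ℝ) (r : ℝ) (v : Fin 4 → ℝ) (a : Fin 4) :
    lower g (fun i => r * v i) a = r * lower g v a := by
  simp only [lower, Finset.mul_sum]
  exact Finset.sum_congr rfl fun _ _ => by ring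

lemma lower_smul_metric (g : Matrix (Fin 4) (Fin 4) ℝ) (r : ℝ) (v : Fin 4 → ℝ) (a : Fin 4) :
    lower (r • g) v a = r * lower g v a := by
  simp only [lower, Finset.mul_sum, Matrix.smul_apply, smul_eq_mul, mul_assoc]

lemma pderiv_congr {i : Fin 4} {f h : Coord → ℝ} {x : Coord} (hfh : f =ᶠ[𝓝 x] h) :
    pderiv i f x = pderiv i h x := by
  rw [pderiv, pderiv, hfh.fderiv_eq]

lemma pderiv_mul {i : Fin 4} {f h : Coord → ℝ} {x : Coord} (hf : DifferentiableAt ℝ f x)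
    (hh : DifferentiableAt ℝ h x) :
    pderiv i (fun z => f z * h z) x = f x * pderiv i h x + h x * pderiv i f x := by
  simp [pderiv, fderiv_fun_mul hf hh]

namespace IsConformalAt

variable {G g : Coord → Matrix (Fin 4) (Fin 4) ℝ} {u W : Coord → Fin 4 → ℝ} {ρ : Coord → ℝ}
  {y : ℝ} {F : Fin 4 → ℝ} {x : Coord}

lemma metric_at (h : IsConformalAt G u g W ρ y F x) : G x = ρ x ^ 2 • g x :=
  h.metric_eq.self_of_nhds

lemma field_at (h : IsConformalAt G u g W ρ y F x) (a : Fin 4) : u x a = (ρ x)⁻¹ * W x a := by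
  rw [h.field_eq.self_of_nhds, Pi.smul_apply, smul_eq_mul]

lemma inv_metric (h : IsConformalAt G u g W ρ y F x) (a b : Fin 4) :
    (G x)⁻¹ a b = (ρ x ^ 2)⁻¹ * (g x)⁻¹ a b := by
  rw [h.metric_at]
  exact congrFun (congrFun (Matrix.inv_smul' (g x)
    (Units.mk0 (ρ x ^ 2) (pow_ne_zero 2 h.factor_ne)) h.metric_det) a) b

lemma pderiv_metric (h : IsConformalAt G u g W ρ y F x) (i a b : Fin 4) :
    pderiv i (fun z => G z a b) x =
      ρ x ^ 2 * (pderiv i (fun z => g z a b) x + 2 * y * F i * g x a b) := by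
  have h1 : (fun z => G z a b) =ᶠ[𝓝 x] fun z => (ρ z * ρ z) * g z a b := by
    filter_upwards [h.metric_eq] with z hz
    rw [hz, Matrix.smul_apply, smul_eq_mul, sq]
  rw [pderiv_congr h1, pderiv_mul (h.factor_diff.fun_mul h.factor_diff) (h.metric_diff a b),
    pderiv_mul h.factor_diff h.factor_diff, h.factor_pderiv]
  ring

lemma pderiv_field (h : IsConformalAt G u g W ρ y F x) (i a : Fin 4) :
    pderiv i (fun z => u z a) x =
      (ρ x)⁻¹ * (pderiv i (fun z => W z a) x - y * F i * W x a) := by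
  have hne := h.factor_ne
  -- Differentiating `ρ u = W` avoids the derivative of a quotient.
  have hud : DifferentiableAt ℝ (fun z => (ρ z)⁻¹ * W z a) x :=
    (h.factor_diff.inv hne).mul (h.field_diff a)
  have h1 : (fun z => u z a) =ᶠ[𝓝 x] fun z => (ρ z)⁻¹ * W z a := by
    filter_upwards [h.field_eq] with z hz
    rw [hz, Pi.smul_apply, smul_eq_mul]
  have h2 : (fun z => ρ z * ((ρ z)⁻¹ * W z a)) =ᶠ[𝓝 x] fun z => W z a := by
    filter_upwards [h.factor_diff.continuousAt.eventually_ne hne] with z hz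
    field_simp
  have h3 := pderiv_congr (i := i) h2
  rw [pderiv_mul h.factor_diff hud, h.factor_pderiv] at h3
  rw [pderiv_congr h1, ← h3]
  field_simp
  ring

/-- `Γ^a_{bc} = Γ̃^a_{bc} + y (F_b δ^a_c + F_c δ^a_b - F^a g_{bc})`. -/
lemma christoffel_eq (h : IsConformalAt G u g W ρ y F x) (a b c : Fin 4) :
    christoffel G x a b c = christoffel g x a b c +
      y * (F b * (if a = c then 1 else 0) + F c * (if a = b then 1 else 0)
        - raise (g x) F a * g x b c) := by
  have hne := h.factor_ne
  simp only [christoffel, h.inv_metric, h.pderiv_metric, raise, ← sum_inv_mul_eq_ite h.metric_det,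
    Finset.mul_sum, Finset.sum_mul, ← Finset.sum_add_distrib, ← Finset.sum_sub_distrib]
  refine Finset.sum_congr rfl fun d _ => ?_
  field_simp
  ring

/-- `u^a_{;b} = (W^a_{;b} + y (F(W) δ^a_b - F^a W_b)) / ρ`. -/
lemma covDeriv_eq (h : IsConformalAt G u g W ρ y F x) (a b : Fin 4) :
    covDeriv G u x a b = (ρ x)⁻¹ * (covDeriv g W x a b +
      y * (pairing F (W x) * (if a = b then 1 else 0)
        - raise (g x) F a * lower (g x) (W x) b)) := by
  have e1 : ∑ c, christoffel G x a b c * u x c = (ρ x)⁻¹ * (∑ c, christoffel g x a b c * W x c +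
      y * (F b * W x a + pairing F (W x) * (if a = b then 1 else 0)
        - raise (g x) F a * lower (g x) (W x) b)) := by
    have e2 : W x a = ∑ c, (if a = c then 1 else 0) * W x c := by simp
    nth_rw 1 [e2]
    simp only [h.christoffel_eq, h.field_at, pairing, lower, Finset.mul_sum, Finset.sum_mul,
      ← Finset.sum_add_distrib, ← Finset.sum_sub_distrib]
    exact Finset.sum_congr rfl fun c _ => by ring
  rw [covDeriv, e1, h.pderiv_field, covDeriv]
  ring

lemma sum_raise_mul_lower (h : IsConformalAt G u g W ρ y F x) :
    ∑ a, raise (g x) F a * lower (g x) (W x) a = pairing F (W x) := by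
  change (g x)⁻¹.mulVec F ⬝ᵥ (g x).mulVec (W x) = F ⬝ᵥ W x
  rw [Matrix.dotProduct_mulVec, ← Matrix.mulVec_transpose, h.metric_symm.eq, Matrix.mulVec_mulVec,
    Matrix.mul_nonsing_inv _ h.metric_det, Matrix.one_mulVec]

/-- `θ = (θ̃ + 3 y F(W)) / ρ`. -/
lemma expansion_eq (h : IsConformalAt G u g W ρ y F x) :
    coordExpansion G u x = (ρ x)⁻¹ * (coordExpansion g W x + 3 * y * pairing F (W x)) := by
  simp only [coordExpansion, h.covDeriv_eq, ← Finset.mul_sum, Finset.sum_add_distrib,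
    Finset.sum_sub_distrib, h.sum_raise_mul_lower]
  simp
  left
  ring

/-- `u̇^a = (A^a + y (F^a + F(W) W^a)) / ρ²`, where `A` is the acceleration of `W`. -/
lemma accel_eq (h : IsConformalAt G u g W ρ y F x) (a : Fin 4) :
    coordAccel G u x a =
      (ρ x ^ 2)⁻¹ * (coordAccel g W x a + y * spatialGrad (g x) F (W x) a) := by
  have hne := h.factor_ne
  have e1 : ∑ b, (pairing F (W x) * (if a = b then 1 else 0)
      - raise (g x) F a * lower (g x) (W x) b) * W x b = spatialGrad (g x) F (W x) a := by
    have e2 := h.field_unit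
    simp only [sub_mul, Finset.sum_sub_distrib, mul_assoc, ← Finset.mul_sum]
    simp only [mul_comm (lower _ _ _), e2, spatialGrad]
    simp
    ring
  rw [← e1]
  simp only [coordAccel, h.covDeriv_eq, h.field_at, Finset.mul_sum, ← Finset.sum_add_distrib]
  refine Finset.sum_congr rfl fun b _ => ?_
  field_simp

lemma lower_field (h : IsConformalAt G u g W ρ y F x) (a : Fin 4) :
    lower (G x) (u x) a = ρ x * lower (g x) (W x) a := by
  have hne := h.factor_ne
  have e : u x = fun i => (ρ x)⁻¹ * W x i := funext h.field_at
  rw [e, h.metric_at, lower_smul_metric, lower_mul]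
  field_simp

lemma lower_accel (h : IsConformalAt G u g W ρ y F x) (a : Fin 4) :
    lower (G x) (coordAccel G u x) a = lower (g x) (coordAccel g W x) a +
      y * (F a + pairing F (W x) * lower (g x) (W x) a) := by
  have hne := h.factor_ne
  have e : coordAccel G u x = fun i =>
      (ρ x ^ 2)⁻¹ * (coordAccel g W x i + y * spatialGrad (g x) F (W x) i) := funext h.accel_eq
  have e2 : lower (g x) (spatialGrad (g x) F (W x)) a
      = F a + pairing F (W x) * lower (g x) (W x) a := by
    have : spatialGrad (g x) F (W x) = fun i => raise (g x) F i + pairing F (W x) * W x i := rfl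
    rw [this, lower_add, lower_mul]
    rw [lower_raise h.metric_det]
  rw [e, h.metric_at, lower_smul_metric, lower_mul, lower_add, lower_mul, e2]
  field_simp

lemma covDerivLow_eq (h : IsConformalAt G u g W ρ y F x) (a b : Fin 4) :
    covDerivLow G u x a b = ρ x * (covDerivLow g W x a b +
      y * (pairing F (W x) * g x a b - F a * lower (g x) (W x) b)) := by
  have hne := h.factor_ne
  have e1 : F a = ∑ c, g x a c * raise (g x) F c := (congrFun (lower_raise h.metric_det F) a).symm
  have e2 : g x a b = ∑ c, g x a c * (if c = b then 1 else 0) := by simp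
  rw [e1]
  nth_rw 1 [e2]
  simp only [covDerivLow, h.covDeriv_eq, h.metric_at, Matrix.smul_apply, smul_eq_mul,
    Finset.mul_sum, Finset.sum_mul, ← Finset.sum_add_distrib, ← Finset.sum_sub_distrib]
  refine Finset.sum_congr rfl fun c _ => ?_
  field_simp

/-- `σ_{ab} = ρ σ̃_{ab}`. -/
lemma shearTensor_eq (h : IsConformalAt G u g W ρ y F x) (a b : Fin 4) :
    shearTensor G u x a b = ρ x * shearTensor g W x a b := by
  have hne := h.factor_ne
  have hs : g x b a = g x a b := h.metric_symm.apply a b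
  have hG : G x a b = ρ x ^ 2 * g x a b := by rw [h.metric_at]; rfl
  simp only [shearTensor, projTensor, h.covDerivLow_eq, h.lower_accel, h.lower_field,
    h.expansion_eq, hs, hG]
  field_simp
  ring

/-- `ω_{ab} = ρ ω̃_{ab}`. -/
lemma vorticityTensor_eq (h : IsConformalAt G u g W ρ y F x) (a b : Fin 4) :
    vorticityTensor G u x a b = ρ x * vorticityTensor g W x a b := by
  have hs : g x b a = g x a b := h.metric_symm.apply a b
  simp only [vorticityTensor, h.covDerivLow_eq, h.lower_accel, h.lower_field, hs]
  ring

lemma contractSq_eq (h : IsConformalAt G u g W ρ y F x) {S R : Fin 4 → Fin 4 → ℝ}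
    (hS : ∀ a b, S a b = ρ x * R a b) :
    contractSq (G x) S = (ρ x ^ 2)⁻¹ * contractSq (g x) R := by
  have hne := h.factor_ne
  simp only [contractSq, hS, h.inv_metric, Finset.mul_sum]
  refine Finset.sum_congr rfl fun a _ => Finset.sum_congr rfl fun b _ =>
    Finset.sum_congr rfl fun c _ => Finset.sum_congr rfl fun d _ => ?_
  field_simp

lemma shearSq_eq (h : IsConformalAt G u g W ρ y F x) :
    coordShearSq G u x = (ρ x ^ 2)⁻¹ * coordShearSq g W x := by
  rw [coordShearSq, h.contractSq_eq h.shearTensor_eq, coordShearSq]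
  ring

lemma vorticitySq_eq (h : IsConformalAt G u g W ρ y F x) :
    coordVorticitySq G u x = (ρ x ^ 2)⁻¹ * coordVorticitySq g W x := by
  rw [coordVorticitySq, h.contractSq_eq h.vorticityTensor_eq, coordVorticitySq]
  ring

/-- The acceleration scalar is `ρ⁻²` times a quadratic polynomial in `y`, whose leading coefficient
vanishes where the gradient is parallel to `W`. -/
lemma accelSq_eq (h : IsConformalAt G u g W ρ y F x) :
    coordAccelSq G u x = (ρ x ^ 2)⁻¹ * (coordAccelSq g W x
      + y * (∑ a, coordAccel g W x a * lower (g x) (spatialGrad (g x) F (W x)) a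
        + ∑ a, spatialGrad (g x) F (W x) a * lower (g x) (coordAccel g W x) a)
      + y ^ 2 * ∑ a, spatialGrad (g x) F (W x) a * lower (g x) (spatialGrad (g x) F (W x)) a) := by
  have hne := h.factor_ne
  have e : coordAccel G u x = fun i =>
      (ρ x ^ 2)⁻¹ * (coordAccel g W x i + y * spatialGrad (g x) F (W x) i) := funext h.accel_eq
  simp only [coordAccelSq, e, h.metric_at, lower_smul_metric, lower_mul, lower_add,
    Finset.mul_sum, ← Finset.sum_add_distrib]
  refine Finset.sum_congr rfl fun a _ => ?_
  field_simp
  ring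

end IsConformalAt

/-! ### Components in a chart -/

section Chart

variable {M : Type*} [TopologicalSpace M] [ChartedSpace Coord M]
  {e : OpenPartialHomeomorph M Coord}

lemma mdifferentiable_of_mem_maximalAtlas (he : e ∈ IsManifold.maximalAtlas (𝓡 4) ∞ M) :
    e.MDifferentiable (𝓡 4) (𝓡 4) :=
  ⟨(contMDiffOn_of_mem_maximalAtlas he).mdifferentiableOn (by simp),
    (contMDiffOn_symm_of_mem_maximalAtlas he).mdifferentiableOn (by simp)⟩

lemma contDiffAt_vectorComp [IsManifold (𝓡 4) ∞ M]
    (he : e ∈ IsManifold.maximalAtlas (𝓡 4) ∞ M) {n : ℕ∞} {w : VField M}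
    {V : Set M} (hV : IsOpen V) (hw : IsVFieldOfClassOn n w V) {x : Coord} (hx : x ∈ e.target)
    (hxV : e.symm x ∈ V) (a : Fin 4) : ContDiffAt ℝ n (fun z => vectorComp e w z a) x := by
  have h1 : ContMDiffOn (𝓡 4).tangent (𝓡 4).tangent n
      (tangentMapWithin (𝓡 4) (𝓡 4) e e.source)
      (Bundle.TotalSpace.proj ⁻¹' e.source : Set (TangentBundle (𝓡 4) M)) :=
    (contMDiffOn_of_mem_maximalAtlas he).contMDiffOn_tangentMapWithin
      (by exact_mod_cast le_top) e.open_source.uniqueMDiffOn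
  have h2 : ContMDiffOn (𝓡 4) (𝓡 4).tangent n (fun z : Coord =>
      (⟨e.symm z, w (e.symm z)⟩ : TangentBundle (𝓡 4) M)) (e.target ∩ e.symm ⁻¹' V) :=
    hw.comp (((contMDiffOn_symm_of_mem_maximalAtlas he).of_le (by exact_mod_cast le_top)).mono
      inter_subset_left) fun z hz => hz.2
  have h3 := contMDiff_snd_tangentBundle_modelSpace Coord (𝓡 4) (n := n)
  have h4 := h3.comp_contMDiffOn (h1.comp h2 fun z hz => e.map_target hz.1)
  have hopen : IsOpen (e.target ∩ e.symm ⁻¹' V) := e.isOpen_inter_preimage_symm hV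
  have h5 := (h4.contMDiffAt (hopen.mem_nhds ⟨hx, hxV⟩)).contDiffAt
  have h6 := (contDiff_euclidean (n := n) (f := (id : Coord → Coord))).1 contDiff_id a
  refine (h6.contDiffAt.comp x h5).congr_of_eventuallyEq ?_
  filter_upwards [hopen.mem_nhds ⟨hx, hxV⟩] with z hz
  exact congrArg (fun A : Coord →L[ℝ] Coord => A (w (e.symm z)) a)
    (mfderivWithin_of_isOpen e.open_source (e.map_target hz.1)).symm

lemma contMDiffAt_coordVector [IsManifold (𝓡 4) ∞ M]
    (he : e ∈ IsManifold.maximalAtlas (𝓡 4) ∞ M) (n : ℕ∞) {x : Coord}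
    (hx : x ∈ e.target) (i : Fin 4) : ContMDiffAt (𝓡 4) (𝓡 4).tangent n
      (fun z : Coord => (⟨e.symm z, coordVector e z i⟩ : TangentBundle (𝓡 4) M)) x := by
  have h1 : ContMDiffOn (𝓡 4).tangent (𝓡 4).tangent n
      (tangentMapWithin (𝓡 4) (𝓡 4) e.symm e.target)
      (Bundle.TotalSpace.proj ⁻¹' e.target : Set (TangentBundle (𝓡 4) Coord)) :=
    (contMDiffOn_symm_of_mem_maximalAtlas he).contMDiffOn_tangentMapWithin
      (by exact_mod_cast le_top) e.open_target.uniqueMDiffOn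
  have h2 : ContMDiff (𝓡 4) (𝓡 4).tangent n (fun z : Coord =>
      (⟨z, (EuclideanSpace.single i (1 : ℝ) : Coord)⟩ : TangentBundle (𝓡 4) Coord)) :=
    contMDiff_vectorSpace_iff_contDiff.2 contDiff_const
  have h3 := (h1.comp (h2.contMDiffOn (s := e.target)) fun z hz => hz).contMDiffAt
    (e.open_target.mem_nhds hx)
  refine h3.congr_of_eventuallyEq ?_
  filter_upwards [e.open_target.mem_nhds hx] with z hz
  simp only [coordVector, Function.comp_apply, tangentMapWithin]
  rw [mfderivWithin_of_isOpen e.open_target hz]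

lemma contDiffAt_metricComp [IsManifold (𝓡 4) ∞ M]
    (he : e ∈ IsManifold.maximalAtlas (𝓡 4) ∞ M) {n : ℕ∞} {g : BilinField M}
    {U : Set M} (hU : IsOpen U) (hg : IsLorentzMetricOn n g U) {x : Coord} (hx : x ∈ e.target)
    (hxU : e.symm x ∈ U) (a b : Fin 4) : ContDiffAt ℝ n (fun z => metricComp e g z a b) x := by
  have h1 := ((hg.contMDiffOn.contMDiffAt (hU.mem_nhds hxU)).comp x
    ((contMDiffAt_symm_of_mem_maximalAtlas he hx).of_le (by exact_mod_cast le_top)))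
  have h2 := ContMDiffAt.clm_bundle_apply₂ (F₁ := Coord) (F₂ := Coord) (F₃ := ℝ)
    (E₃ := Bundle.Trivial M ℝ) (b := e.symm) h1
    (contMDiffAt_coordVector he n hx a) (contMDiffAt_coordVector he n hx b)
  exact (Bundle.contMDiffAt_totalSpace.1 h2).2.contDiffAt

lemma contDiffAt_comp_symm (he : e ∈ IsManifold.maximalAtlas (𝓡 4) ∞ M) {T : M → ℝ}
    (hT : ContMDiff (𝓡 4) 𝓘(ℝ, ℝ) ∞ T) {x : Coord} (hx : x ∈ e.target) :
    ContDiffAt ℝ ∞ (fun z => T (e.symm z)) x :=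
  (hT.contMDiffAt.comp x (contMDiffAt_symm_of_mem_maximalAtlas he hx)).contDiffAt

/-- The tangent vector with components `v` in the chart `e`, at the point with coordinates `x`. -/
def tangentVector (e : OpenPartialHomeomorph M Coord) (x : Coord) (v : Fin 4 → ℝ) :
    TangentSpace (𝓡 4) (e.symm x) :=
  ∑ i, v i • coordVector e x i

lemma tangentVector_eq_mfderiv (x : Coord) (v : Fin 4 → ℝ) :
    tangentVector e x v = mfderiv (𝓡 4) (𝓡 4) e.symm x (WithLp.toLp 2 v : Coord) := by
  have h : (WithLp.toLp 2 v : Coord) = ∑ i, v i • (EuclideanSpace.single i (1 : ℝ) : Coord) := by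
    ext j
    simp [Pi.single_apply]
  let A : Coord →L[ℝ] TangentSpace (𝓡 4) (e.symm x) := mfderiv (𝓡 4) (𝓡 4) e.symm x
  change _ = A (WithLp.toLp 2 v)
  rw [h, map_sum, tangentVector]
  simp only [map_smul]
  rfl

lemma tangentVector_vectorComp (he : e ∈ IsManifold.maximalAtlas (𝓡 4) ∞ M) (w : VField M)
    {x : Coord} (hx : x ∈ e.target) : tangentVector e x (vectorComp e w x) = w (e.symm x) := by
  have h := (mdifferentiable_of_mem_maximalAtlas he).symm_comp_deriv (e.map_target hx)
  rw [tangentVector_eq_mfderiv]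
  have h2 := congrArg (fun A : Coord →L[ℝ] Coord => A (w (e.symm x))) h
  rw [e.right_inv hx] at h2
  exact h2

lemma exists_tangentVector_eq (he : e ∈ IsManifold.maximalAtlas (𝓡 4) ∞ M) {x : Coord}
    (hx : x ∈ e.target) (v : TangentSpace (𝓡 4) (e.symm x)) : ∃ c, tangentVector e x c = v := by
  classical
  -- Any vector field through `v` will do.
  refine ⟨vectorComp e (Function.update (0 : VField M) (e.symm x) v) x, ?_⟩
  rw [tangentVector_vectorComp he _ hx, Function.update_self]

lemma tangentVector_eq_zero (he : e ∈ IsManifold.maximalAtlas (𝓡 4) ∞ M) {x : Coord}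
    (hx : x ∈ e.target) {v : Fin 4 → ℝ} (hv : tangentVector e x v = 0) : v = 0 := by
  have h := (mdifferentiable_of_mem_maximalAtlas he).comp_symm_deriv hx
  have h2 := congrArg (fun A : Coord →L[ℝ] Coord => A (WithLp.toLp 2 v)) h
  have h3 : (mfderiv (𝓡 4) (𝓡 4) e (e.symm x)) (tangentVector e x v) =
    (WithLp.toLp 2 v : Coord) := by rw [tangentVector_eq_mfderiv]; exact h2
  rw [hv, map_zero] at h3
  ext i
  exact (congrArg (fun z : Coord => z i) h3).symm

/-- The metric in components: `g(v, w) = v^a w_a`. -/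
lemma metric_tangentVector (g : BilinField M) (x : Coord) (v w : Fin 4 → ℝ) :
    g (e.symm x) (tangentVector e x v) (tangentVector e x w) =
      ∑ a, v a * lower (metricComp e g x) w a := by
  simp only [tangentVector, map_sum, map_smul, sum_apply,
    smul_apply, lower, metricComp, Matrix.of_apply, Finset.mul_sum,
    smul_eq_mul]
  rw [Finset.sum_comm]
  refine Finset.sum_congr rfl fun a _ => Finset.sum_congr rfl fun b _ => ?_
  ring

lemma tangentVector_single (x : Coord) (i : Fin 4) :
    tangentVector e x (Pi.single i 1) = coordVector e x i := by
  simp [tangentVector, Pi.single_apply]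

lemma IsLorentzianAt.symm {g : BilinField M} {p : M} (h : IsLorentzianAt g p)
    (v w : TangentSpace (𝓡 4) p) : g p v w = g p w v := by
  obtain ⟨b, hb⟩ := h
  rw [← b.sum_repr v, ← b.sum_repr w]
  simp only [map_sum, map_smul, sum_apply, smul_apply,
    smul_eq_mul, hb, Finset.mul_sum]
  rw [Finset.sum_comm]
  refine Finset.sum_congr rfl fun i _ => Finset.sum_congr rfl fun j _ => ?_
  by_cases hij : i = j
  · subst hij; ring
  · simp [hij, Ne.symm hij]

lemma IsLorentzianAt.eq_zero_of_forall {g : BilinField M} {p : M} (h : IsLorentzianAt g p)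
    {w : TangentSpace (𝓡 4) p} (hw : ∀ v, g p v w = 0) : w = 0 := by
  obtain ⟨b, hb⟩ := h
  rw [← b.sum_repr w]
  refine Finset.sum_eq_zero fun i _ => ?_
  have h1 := hw (b i)
  rw [← b.sum_repr w] at h1
  simp only [map_sum, map_smul, smul_eq_mul, hb] at h1
  have h2 : b.repr w i = 0 := by
    rcases eq_or_ne i 0 with hi | hi <;> simpa [hi] using h1
  rw [h2, zero_smul]

lemma metricComp_isSymm {g : BilinField M} {x : Coord} (hg : IsLorentzianAt g (e.symm x)) :
    (metricComp e g x).IsSymm :=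
  Matrix.IsSymm.ext fun _ _ => hg.symm _ _

lemma isUnit_det_metricComp (he : e ∈ IsManifold.maximalAtlas (𝓡 4) ∞ M) {g : BilinField M}
    {x : Coord} (hx : x ∈ e.target) (hg : IsLorentzianAt g (e.symm x)) :
    IsUnit (metricComp e g x).det := by
  rw [isUnit_iff_ne_zero]
  intro h
  obtain ⟨v, hv, hv0⟩ := Matrix.exists_mulVec_eq_zero_iff.2 h
  refine hv (tangentVector_eq_zero he hx (hg.eq_zero_of_forall fun z => ?_))
  obtain ⟨c, rfl⟩ := exists_tangentVector_eq he hx z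
  rw [metric_tangentVector]
  have : lower (metricComp e g x) v = 0 := hv0
  simp [this]

lemma pderiv_comp_symm (he : e ∈ IsManifold.maximalAtlas (𝓡 4) ∞ M) {T : M → ℝ}
    (hT : ContMDiff (𝓡 4) 𝓘(ℝ, ℝ) ∞ T) {x : Coord} (hx : x ∈ e.target) (i : Fin 4) :
    pderiv i (fun z => T (e.symm z)) x = dirDeriv T (e.symm x) (coordVector e x i) := by
  have h := mfderiv_comp x (hT.contMDiffAt.mdifferentiableAt (by simp) :
      MDifferentiableAt (𝓡 4) 𝓘(ℝ, ℝ) T (e.symm x))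
    ((mdifferentiable_of_mem_maximalAtlas he).mdifferentiableAt_symm hx)
  rw [mfderiv_eq_fderiv] at h
  exact congrArg (fun A : Coord →L[ℝ] ℝ => A (EuclideanSpace.single i (1 : ℝ))) h

lemma pairing_pderiv (he : e ∈ IsManifold.maximalAtlas (𝓡 4) ∞ M) {T : M → ℝ}
    (hT : ContMDiff (𝓡 4) 𝓘(ℝ, ℝ) ∞ T) {x : Coord} (hx : x ∈ e.target) (v : Fin 4 → ℝ) :
    pairing (fun i => pderiv i (fun z => T (e.symm z)) x) v =
      dirDeriv T (e.symm x) (tangentVector e x v) := by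
  have h : dirDeriv T (e.symm x) (tangentVector e x v) =
      ∑ i, v i • dirDeriv T (e.symm x) (coordVector e x i) := by
    change mfderiv (𝓡 4) 𝓘(ℝ, ℝ) T (e.symm x) (∑ i, v i • coordVector e x i) = _
    rw [map_sum]
    simp only [map_smul]
    rfl
  rw [h, pairing]
  exact Finset.sum_congr rfl fun i _ => by rw [pderiv_comp_symm he hT hx, smul_eq_mul, mul_comm]

/-- A unit timelike vector orthogonal to the slice is not tangent to it: otherwise it would be
orthogonal to itself. -/
lemma dirDeriv_ne_zero_of_orthogonal {g : BilinField M} {T : M → ℝ} {p : M}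
    {w : TangentSpace (𝓡 4) p} (hw : g p w w = -1)
    (horth : ∀ v : TangentSpace (𝓡 4) p, dirDeriv T p v = 0 → g p w v = 0) :
    dirDeriv T p w ≠ 0 := by
  intro h
  have := horth w h
  rw [hw] at this
  norm_num at this

/-- The differential of `T` in terms of a unit normal: `dT(v) = -dT(w) g(w, v)`. -/
lemma dirDeriv_add_mul_eq_zero {g : BilinField M} {T : M → ℝ} {p : M}
    {w : TangentSpace (𝓡 4) p} (hw : g p w w = -1)
    (horth : ∀ v : TangentSpace (𝓡 4) p, dirDeriv T p v = 0 → g p w v = 0)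
    (v : TangentSpace (𝓡 4) p) : dirDeriv T p v + dirDeriv T p w * g p w v = 0 := by
  have h0 := dirDeriv_ne_zero_of_orthogonal hw horth
  have hlin : ∀ a b : ℝ, dirDeriv T p (a • v - b • w) = a * dirDeriv T p v - b * dirDeriv T p w :=
    fun a b => by
      change mfderiv (𝓡 4) 𝓘(ℝ, ℝ) T p (a • v - b • w) = _
      rw [map_sub, map_smul, map_smul]
      rfl
  have h1 := horth (dirDeriv T p w • v - dirDeriv T p v • w) (by rw [hlin]; ring)
  rw [map_sub, map_smul, map_smul, hw, smul_eq_mul, smul_eq_mul] at h1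
  linarith

/-- In the chart, near a point of the physical side, the physical metric and congruence arise from the
regular ones by the conformal factor `Ω ∘ T`. -/
lemma isConformalAt_physicalMetric [IsManifold (𝓡 4) ∞ M]
    (he : e ∈ IsManifold.maximalAtlas (𝓡 4) ∞ M)
    {g : BilinField M} {U V : Set M} (hU : IsOpen U) (hg : IsLorentzMetricOn 2 g U) {T : M → ℝ}
    (hT : ContMDiff (𝓡 4) 𝓘(ℝ, ℝ) ∞ T) {u w : VField M} (hV : IsOpen V)
    (hw : IsVFieldOfClassOn 2 w V) (hunit : IsUnitTimelikeOn g w V) {s : Set ℝ} (hs : IsOpen s)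
    {Ω : ℝ → ℝ} (hwu : ∀ p ∈ V, T p ∈ s → w p = Ω (T p) • u p) {x : Coord} (hx : x ∈ e.target)
    (hxU : e.symm x ∈ U) (hxV : e.symm x ∈ V) (hxs : T (e.symm x) ∈ s)
    (hne : Ω (T (e.symm x)) ≠ 0) (hd : DifferentiableAt ℝ Ω (T (e.symm x))) :
    IsConformalAt (metricComp e (physicalMetric g T Ω)) (vectorComp e u) (metricComp e g)
      (vectorComp e w) (fun z => Ω (T (e.symm z)))
      (deriv Ω (T (e.symm x)) / Ω (T (e.symm x)))
      (fun i => pderiv i (fun z => T (e.symm z)) x) x := by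
  have hTd : DifferentiableAt ℝ (fun z => T (e.symm z)) x :=
    (contDiffAt_comp_symm he hT hx).differentiableAt (by simp)
  have hρ : DifferentiableAt ℝ (fun z => Ω (T (e.symm z))) x := hd.comp x hTd
  refine
    { metric_eq := Eventually.of_forall fun z => ?_
      field_eq := ?_
      factor_ne := hne
      factor_diff := hρ
      factor_pderiv := fun i => ?_
      metric_diff := fun a b =>
        (contDiffAt_metricComp he hU hg hx hxU a b).differentiableAt (by simp)
      field_diff := fun a => (contDiffAt_vectorComp he hV hw hx hxV a).differentiableAt (by simp)
      metric_symm := metricComp_isSymm (hg.lorentzian _ hxU)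
      metric_det := isUnit_det_metricComp he hx (hg.lorentzian _ hxU)
      field_unit := ?_ }
  · rfl
  · have hc : ContinuousAt e.symm x := e.continuousAt_symm hx
    filter_upwards [hρ.continuousAt.eventually_ne hne, hc.eventually (hV.mem_nhds hxV),
      (hTd.continuousAt).eventually (hs.mem_nhds hxs)] with z hz hzV hzs
    have h1 : vectorComp e w z = Ω (T (e.symm z)) • vectorComp e u z := by
      ext a
      change (show Coord from mfderiv (𝓡 4) (𝓡 4) e (e.symm z) (w (e.symm z))) a = _
      rw [hwu _ hzV hzs, map_smul]
      rfl
    rw [h1, smul_smul, inv_mul_cancel₀ hz, one_smul]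
  · have h1 := hd.hasDerivAt.comp_hasFDerivAt x hTd.hasFDerivAt
    have h2 : fderiv ℝ (fun z => Ω (T (e.symm z))) x = _ := h1.fderiv
    rw [pderiv, h2, pderiv]
    simp only [smul_apply, smul_eq_mul]
    field_simp
  · rw [← metric_tangentVector, tangentVector_vectorComp he w hx]
    exact hunit _ hxV

/-- On the slice the gradient of `T` is parallel to the unit normal `w`. -/
lemma spatialGrad_eq_zero_of_orthogonal (he : e ∈ IsManifold.maximalAtlas (𝓡 4) ∞ M)
    {g : BilinField M} {T : M → ℝ} (hT : ContMDiff (𝓡 4) 𝓘(ℝ, ℝ) ∞ T) {w : VField M} {x : Coord}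
    (hx : x ∈ e.target) (hg : IsLorentzianAt g (e.symm x))
    (hw : g (e.symm x) (w (e.symm x)) (w (e.symm x)) = -1)
    (horth : ∀ v, dirDeriv T (e.symm x) v = 0 → g (e.symm x) (w (e.symm x)) v = 0) :
    spatialGrad (metricComp e g x) (fun i => pderiv i (fun z => T (e.symm z)) x)
      (vectorComp e w x) = 0 := by
  have hdet := isUnit_det_metricComp he hx hg
  rw [← raise_lower hdet (spatialGrad _ _ _)]
  have h0 : lower (metricComp e g x) (spatialGrad (metricComp e g x)
      (fun i => pderiv i (fun z => T (e.symm z)) x) (vectorComp e w x)) = 0 := by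
    ext i
    have h1 := dirDeriv_add_mul_eq_zero hw horth (coordVector e x i)
    rw [hg.symm, ← tangentVector_vectorComp he w hx, ← pairing_pderiv he hT hx,
      ← pderiv_comp_symm he hT hx, ← tangentVector_single, metric_tangentVector] at h1
    simp only [Pi.single_apply, ite_mul, one_mul, zero_mul, Finset.sum_ite_eq',
      Finset.mem_univ, if_true] at h1
    unfold spatialGrad
    rw [lower_add, lower_mul, lower_raise hdet]
    exact h1
  rw [h0]
  ext a
  simp [raise]

end Chart

/-! ### Continuity of the kinematic quantities -/

lemma continuousAt_pderiv {f : Coord → ℝ} {x : Coord} (hf : ContDiffAt ℝ 1 f x) (i : Fin 4) :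
    ContinuousAt (fun z => pderiv i f z) x :=
  (hf.fderiv_right (m := 0) (by simp)).continuousAt.clm_apply continuousAt_const

section Continuity

variable {g : Coord → Matrix (Fin 4) (Fin 4) ℝ} {W : Coord → Fin 4 → ℝ} {x : Coord}

lemma continuousAt_inv_metric (hg : ContinuousAt g x) (hdet : IsUnit (g x).det) (a b : Fin 4) :
    ContinuousAt (fun z => (g z)⁻¹ a b) x := by
  have h1 : ContinuousAt (fun z => (g z).det) x := by fun_prop
  have h2 : ContinuousAt (fun z => (g z).adjugate) x := by fun_prop
  have h3 : ContinuousAt (fun z => (g z).adjugate a b) x :=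
    continuousAt_pi.1 (continuousAt_pi.1 h2 a) b
  simp only [Matrix.inv_def, Ring.inverse_eq_inv', Matrix.smul_apply, smul_eq_mul]
  exact (h1.inv₀ hdet.ne_zero).mul h3

lemma continuousAt_lower {v : Coord → Fin 4 → ℝ} (hg : ∀ a b, ContinuousAt (fun z => g z a b) x)
    (hv : ∀ a, ContinuousAt (fun z => v z a) x) (a : Fin 4) :
    ContinuousAt (fun z => lower (g z) (v z) a) x := by
  unfold ConformalCosmology.lower
  fun_prop

lemma continuousAt_contractSq {S : Coord → Fin 4 → Fin 4 → ℝ}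
    (hg : ∀ a b, ContinuousAt (fun z => (g z)⁻¹ a b) x)
    (hS : ∀ a b, ContinuousAt (fun z => S z a b) x) :
    ContinuousAt (fun z => contractSq (g z) (S z)) x := by
  unfold contractSq
  fun_prop

variable (hg : ∀ a b, ContDiffAt ℝ 1 (fun z => g z a b) x) (hdet : IsUnit (g x).det)
  (hW : ∀ a, ContDiffAt ℝ 1 (fun z => W z a) x)

include hg in
lemma continuousAt_metric_apply (a b : Fin 4) : ContinuousAt (fun z => g z a b) x :=
  (hg a b).continuousAt

include hg hdet in
lemma continuousAt_inv_metric_apply (a b : Fin 4) : ContinuousAt (fun z => (g z)⁻¹ a b) x :=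
  continuousAt_inv_metric (continuousAt_pi.2 fun a => continuousAt_pi.2 fun b =>
    (hg a b).continuousAt) hdet a b

include hg hdet hW in
lemma continuousAt_covDeriv (a b : Fin 4) : ContinuousAt (fun z => covDeriv g W z a b) x := by
  have h1 := continuousAt_inv_metric_apply hg hdet
  have h2 := fun i a b => continuousAt_pderiv (hg a b) i
  have h3 := fun i a => continuousAt_pderiv (hW a) i
  have h4 := fun a => (hW a).continuousAt
  unfold covDeriv christoffel
  fun_prop

include hg hdet hW in
lemma continuousAt_covDerivLow (a b : Fin 4) : ContinuousAt (fun z => covDerivLow g W z a b) x := by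
  have h1 := continuousAt_covDeriv hg hdet hW
  have h2 := continuousAt_metric_apply hg
  unfold covDerivLow
  fun_prop

include hg hdet hW in
lemma continuousAt_coordExpansion : ContinuousAt (fun z => coordExpansion g W z) x := by
  have h1 := continuousAt_covDeriv hg hdet hW
  unfold coordExpansion
  fun_prop

include hg hdet hW in
lemma continuousAt_coordAccel (a : Fin 4) : ContinuousAt (fun z => coordAccel g W z a) x := by
  have h1 := continuousAt_covDeriv hg hdet hW
  have h4 := fun a => (hW a).continuousAt
  unfold coordAccel
  fun_prop

include hg hdet hW in
lemma continuousAt_coordShearSq : ContinuousAt (fun z => coordShearSq g W z) x := by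
  have h1 := continuousAt_covDerivLow hg hdet hW
  have h2 := continuousAt_metric_apply hg
  have h3 := continuousAt_coordExpansion hg hdet hW
  have h4 := continuousAt_lower h2 (continuousAt_coordAccel hg hdet hW)
  have h5 := continuousAt_lower h2 fun a => (hW a).continuousAt
  unfold coordShearSq
  refine continuousAt_const.mul (continuousAt_contractSq (continuousAt_inv_metric_apply hg hdet)
    fun a b => ?_)
  unfold shearTensor projTensor
  fun_prop

include hg hdet hW in
lemma continuousAt_coordVorticitySq : ContinuousAt (fun z => coordVorticitySq g W z) x := by
  have h1 := continuousAt_covDerivLow hg hdet hW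
  have h2 := continuousAt_metric_apply hg
  have h4 := continuousAt_lower h2 (continuousAt_coordAccel hg hdet hW)
  have h5 := continuousAt_lower h2 fun a => (hW a).continuousAt
  unfold coordVorticitySq
  refine continuousAt_const.mul (continuousAt_contractSq (continuousAt_inv_metric_apply hg hdet)
    fun a b => ?_)
  unfold vorticityTensor
  fun_prop

include hg hdet hW in
lemma continuousAt_spatialGrad {F : Coord → Fin 4 → ℝ} (hF : ∀ a, ContinuousAt (fun z => F z a) x)
    (a : Fin 4) : ContinuousAt (fun z => spatialGrad (g z) (F z) (W z) a) x := by
  have h1 := continuousAt_inv_metric_apply hg hdet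
  have h4 := fun a => (hW a).continuousAt
  unfold spatialGrad raise pairing
  fun_prop

end Continuity

/-! ### Limits of the ratios -/

section Limits

variable {α : Type*} {l : Filter α} {A φ y ρ : α → ℝ} {A₀ φ₀ : ℝ}

lemma eventually_add_mul_ne_zero (hA : Tendsto A l (𝓝 A₀)) (hφ : Tendsto φ l (𝓝 φ₀))
    (hφ₀ : φ₀ ≠ 0) (hy : Tendsto (fun p => |y p|) l atTop) :
    ∀ᶠ p in l, A p + 3 * y p * φ p ≠ 0 := by
  have hz : Tendsto (fun p => (y p)⁻¹) l (𝓝 0) :=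
    (tendsto_zero_iff_abs_tendsto_zero _).2 (by
      simpa [Function.comp_def, abs_inv] using tendsto_inv_atTop_zero.comp hy)
  have h1 : Tendsto (fun p => (y p)⁻¹ * A p + 3 * φ p) l (𝓝 (0 * A₀ + 3 * φ₀)) :=
    (hz.mul hA).add (hφ.const_mul 3)
  have h2 := h1.eventually_ne (by simpa using hφ₀ : 0 * A₀ + 3 * φ₀ ≠ 0)
  filter_upwards [h2, hy.eventually_gt_atTop 0] with p hp hyp h
  refine hp ?_
  have hy0 : y p ≠ 0 := abs_pos.1 hyp
  have h3 : (y p)⁻¹ * A p + 3 * φ p = (y p)⁻¹ * (A p + 3 * y p * φ p) := by field_simp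
  rw [h3, h, mul_zero]

/-- As `|y| → ∞`, the square of `A + 3 y φ` dominates every quadratic polynomial in `y` with
convergent coefficients whose leading coefficient tends to zero. -/
lemma tendsto_quadratic_div_sq_zero (hA : Tendsto A l (𝓝 A₀)) (hφ : Tendsto φ l (𝓝 φ₀))
    (hφ₀ : φ₀ ≠ 0) (hy : Tendsto (fun p => |y p|) l atTop) (hρ : ∀ᶠ p in l, ρ p ≠ 0)
    {a b c : α → ℝ} {a₀ b₀ : ℝ} (ha : Tendsto a l (𝓝 a₀)) (hb : Tendsto b l (𝓝 b₀))
    (hc : Tendsto c l (𝓝 0)) :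
    Tendsto (fun p => ((ρ p ^ 2)⁻¹ * (a p + y p * b p + y p ^ 2 * c p)) /
      ((ρ p)⁻¹ * (A p + 3 * y p * φ p)) ^ 2) l (𝓝 0) := by
  have hz : Tendsto (fun p => (y p)⁻¹) l (𝓝 0) :=
    (tendsto_zero_iff_abs_tendsto_zero _).2 (by
      simpa [Function.comp_def, abs_inv] using tendsto_inv_atTop_zero.comp hy)
  have h1 : Tendsto (fun p => ((y p)⁻¹ ^ 2 * a p + (y p)⁻¹ * b p + c p) /
      ((y p)⁻¹ * A p + 3 * φ p) ^ 2) l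
      (𝓝 ((0 ^ 2 * a₀ + 0 * b₀ + 0) / (0 * A₀ + 3 * φ₀) ^ 2)) :=
    ((((hz.pow 2).mul ha).add (hz.mul hb)).add hc).div (((hz.mul hA).add (hφ.const_mul 3)).pow 2)
      (by simpa using hφ₀)
  have h2 : (0 ^ 2 * a₀ + 0 * b₀ + 0) / (0 * A₀ + 3 * φ₀) ^ 2 = 0 := by simp
  rw [h2] at h1
  refine h1.congr' ?_
  filter_upwards [hρ, hy.eventually_gt_atTop 0,
    eventually_add_mul_ne_zero hA hφ hφ₀ hy] with p hρp hyp hD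
  have hy0 : y p ≠ 0 := abs_pos.1 hyp
  have h3 : (y p)⁻¹ * A p + 3 * φ p = (y p)⁻¹ * (A p + 3 * y p * φ p) := by field_simp
  rw [h3]
  field_simp

end Limits

end ConformalCosmology

end

/-! ### Asymptotic isotropy -/

open ConformalCosmology in
theorem mainTheorem2 {M : Type*} [TopologicalSpace M] [ChartedSpace Coord M]
    [IsManifold (𝓡 4) ∞ M]
    (g : BilinField M) (τ : VField M) (T : M → ℝ) (Ω : ℝ → ℝ) (s : Set ℝ) (U : Set M)
    (hU : IsOpen U) (hTU : {p | T p = 0} ⊆ U)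
    (hg : IsLorentzMetricOn 2 g U)
    (hτ : IsTimeOrientationOn g τ U)
    (hT : IsSmoothCosmicTimeOn g τ T U)
    (hΩ : ConformalFactorCondition Ω s) (hL : LimitLExistsNeOne Ω s)
    (u : VField M) (hu : IsUnitTimelikeOn (physicalMetric g T Ω) u {p | T p ∈ s})
    (hreg : IsRegularOrthogonalAtSlice g T Ω s u)
    (p₀ : M) (hp₀ : T p₀ = 0)
    (e : OpenPartialHomeomorph M Coord) (he : e ∈ IsManifold.maximalAtlas (𝓡 4) ∞ M)
    (hpe : p₀ ∈ e.source) :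
    (∀ᶠ p in 𝓝[{p | T p ∈ s}] p₀, expansion e (physicalMetric g T Ω) u p ≠ 0) ∧
    Tendsto (fun p => shearSq e (physicalMetric g T Ω) u p /
        expansion e (physicalMetric g T Ω) u p ^ 2) (𝓝[{p | T p ∈ s}] p₀) (𝓝 0) ∧
    Tendsto (fun p => vorticitySq e (physicalMetric g T Ω) u p /
        expansion e (physicalMetric g T Ω) u p ^ 2) (𝓝[{p | T p ∈ s}] p₀) (𝓝 0) ∧
    Tendsto (fun p => accelSq e (physicalMetric g T Ω) u p /
        expansion e (physicalMetric g T Ω) u p ^ 2) (𝓝[{p | T p ∈ s}] p₀) (𝓝 0) := by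
  obtain ⟨V, w, hV, hTV, hw, hwu, hwreg, horth⟩ := hreg
  have hs := hΩ.isOpen
  have hx₀ : e p₀ ∈ e.target := e.map_source hpe
  have hsymm : e.symm (e p₀) = p₀ := e.left_inv hpe
  have hU₀ : e.symm (e p₀) ∈ U := by rw [hsymm]; exact hTU hp₀
  have hV₀ : e.symm (e p₀) ∈ V := by rw [hsymm]; exact hTV hp₀
  have hT₀ : T (e.symm (e p₀)) = 0 := by rw [hsymm]; exact hp₀
  -- `x ↦ F x` is `dT` in the chart, and `G`, `W` are the components of the regular metric and field.
  set l := 𝓝[{p | T p ∈ s}] p₀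
  set G := metricComp e g
  set W := vectorComp e w
  set F : Coord → Fin 4 → ℝ := fun x i => pderiv i (fun z => T (e.symm z)) x
  set y : M → ℝ := fun p => deriv Ω (T p) / Ω (T p)
  have hel : Tendsto e l (𝓝 (e p₀)) := (e.continuousAt hpe).tendsto.mono_left nhdsWithin_le_nhds
  have hTl : Tendsto T l (𝓝[s] 0) := by
    refine tendsto_nhdsWithin_iff.2 ⟨?_, self_mem_nhdsWithin⟩
    rw [← hp₀]
    exact hT.smooth.continuous.continuousAt.tendsto.mono_left nhdsWithin_le_nhds
  have hy : Tendsto (fun p => |y p|) l atTop := (hΩ.tendsto_abs_deriv_div_self hL).comp hTl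
  have hρ : ∀ᶠ p in l, Ω (T p) ≠ 0 :=
    (hTl.eventually hΩ.eventually_pos_differentiableAt).mono fun p hp => hp.1.ne'
  -- The conformal transformation formulas hold at every point close to `p₀` on the physical side.
  have key : ∀ᶠ p in l, IsConformalAt (metricComp e (physicalMetric g T Ω)) (vectorComp e u) G W
      (fun z => Ω (T (e.symm z))) (y p) (F (e p)) (e p) ∧ e.symm (e p) = p := by
    have hsrc : ∀ᶠ p in l, p ∈ e.source ∧ p ∈ U ∧ p ∈ V := nhdsWithin_le_nhds
      (inter_mem (e.open_source.mem_nhds hpe)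
        (inter_mem (hU.mem_nhds (hTU hp₀)) (hV.mem_nhds (hTV hp₀))))
    filter_upwards [hsrc, self_mem_nhdsWithin,
      hTl.eventually hΩ.eventually_pos_differentiableAt] with p hp hps hpΩ
    have hsp : e.symm (e p) = p := e.left_inv hp.1
    have h1 := isConformalAt_physicalMetric he hU hg hT.smooth hV hw hwu hs hwreg (x := e p)
      (e.map_source hp.1)
    rw [hsp] at h1
    exact ⟨h1 hp.2.1 hp.2.2 hps hpΩ.1.ne' hpΩ.2, hsp⟩
  have hG : ∀ a b, ContDiffAt ℝ 1 (fun z => G z a b) (e p₀) := fun a b =>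
    (contDiffAt_metricComp he hU hg hx₀ hU₀ a b).of_le (by norm_num)
  have hW : ∀ a, ContDiffAt ℝ 1 (fun z => W z a) (e p₀) := fun a =>
    (contDiffAt_vectorComp he hV hw hx₀ hV₀ a).of_le (by norm_num)
  have hlor := hg.lorentzian _ hU₀
  have hdet : IsUnit (G (e p₀)).det := isUnit_det_metricComp he hx₀ hlor
  have hF : ∀ i, ContinuousAt (fun z => F z i) (e p₀) := fun i =>
    continuousAt_pderiv ((contDiffAt_comp_symm he hT.smooth hx₀).of_le (by simp)) i
  have hunit := hwu _ hV₀
  have horth₀ := horth _ hT₀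
  have hA := (continuousAt_coordExpansion hG hdet hW).tendsto.comp hel
  have hφ : Tendsto (fun p => pairing (F (e p)) (W (e p))) l
      (𝓝 (pairing (F (e p₀)) (W (e p₀)))) := by
    have h1 := fun a => (hW a).continuousAt
    have h2 : ContinuousAt (fun z => pairing (F z) (W z)) (e p₀) := by
      unfold pairing
      fun_prop
    exact h2.tendsto.comp hel
  have hφ₀ : pairing (F (e p₀)) (W (e p₀)) ≠ 0 := by
    rw [pairing_pderiv he hT.smooth hx₀, tangentVector_vectorComp he w hx₀]
    exact dirDeriv_ne_zero_of_orthogonal hunit horth₀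
  have hθ : ∀ᶠ p in l, expansion e (physicalMetric g T Ω) u p =
      (Ω (T p))⁻¹ * (coordExpansion G W (e p) + 3 * y p * pairing (F (e p)) (W (e p))) := by
    filter_upwards [key] with p hp
    rw [expansion, hp.1.expansion_eq, hp.2]
  refine ⟨?_, ?_, ?_, ?_⟩
  · filter_upwards [hθ, hρ, eventually_add_mul_ne_zero hA hφ hφ₀ hy] with p hp hpρ hpD
    rw [hp]
    exact mul_ne_zero (inv_ne_zero hpρ) hpD
  · have h := tendsto_quadratic_div_sq_zero hA hφ hφ₀ hy hρ
      ((continuousAt_coordShearSq hG hdet hW).tendsto.comp hel)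
      (tendsto_const_nhds (x := (0 : ℝ))) (tendsto_const_nhds (x := (0 : ℝ)))
    refine h.congr' ?_
    filter_upwards [key, hθ] with p hp hpθ
    rw [hpθ, shearSq, hp.1.shearSq_eq, hp.2]
    simp
  · have h := tendsto_quadratic_div_sq_zero hA hφ hφ₀ hy hρ
      ((continuousAt_coordVorticitySq hG hdet hW).tendsto.comp hel)
      (tendsto_const_nhds (x := (0 : ℝ))) (tendsto_const_nhds (x := (0 : ℝ)))
    refine h.congr' ?_
    filter_upwards [key, hθ] with p hp hpθ
    rw [hpθ, vorticitySq, hp.1.vorticitySq_eq, hp.2]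
    simp
  · have hg₀ := fun a b => (hG a b).continuousAt
    have hP := continuousAt_spatialGrad hG hdet hW hF
    have hPl := continuousAt_lower hg₀ hP
    have hacc := continuousAt_coordAccel hG hdet hW
    have haccl := continuousAt_lower hg₀ hacc
    have hP₀ : spatialGrad (G (e p₀)) (F (e p₀)) (W (e p₀)) = 0 :=
      spatialGrad_eq_zero_of_orthogonal he hT.smooth hx₀ hlor hunit horth₀
    have ha : ContinuousAt (fun z => coordAccelSq G W z) (e p₀) := by
      unfold coordAccelSq
      fun_prop
    have hb : ContinuousAt (fun z =>
        ∑ a, coordAccel G W z a *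
            ConformalCosmology.lower (G z) (spatialGrad (G z) (F z) (W z)) a
          + ∑ a, spatialGrad (G z) (F z) (W z) a *
            ConformalCosmology.lower (G z) (coordAccel G W z) a) (e p₀) := by
      fun_prop
    have hc : ContinuousAt (fun z => ∑ a, spatialGrad (G z) (F z) (W z) a *
        ConformalCosmology.lower (G z) (spatialGrad (G z) (F z) (W z)) a) (e p₀) := by
      fun_prop
    -- The coefficient of `y²` tends to its value at `p₀`, which is zero since `P` vanishes there.
    have hc' := hc.tendsto.comp hel
    simp only [hP₀, Pi.zero_apply, zero_mul, Finset.sum_const_zero] at hc'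
    have h := tendsto_quadratic_div_sq_zero hA hφ hφ₀ hy hρ (ha.tendsto.comp hel)
      (hb.tendsto.comp hel) hc'
    refine h.congr' ?_
    filter_upwards [key, hθ] with p hp hpθ
    rw [hpθ, accelSq, hp.1.accelSq_eq, hp.2]
    rfl
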